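/- Let $q\in\mathbb{C}$ with $0<|q|<1$, and let $t,m\in\mathbb{Z}$ with $t\ge 1$. Write $(a;q)_\infty=\prod_{n\ge 0}(1-aq^n)$, $(q)_\infty=(q;q)_\infty$, $\Theta(x;q)=(x;q)_\infty(q/x;q)_\infty(q;q)_\infty$, and $\binom{r}{2}=\frac{r(r-1)}{2}$ for $r\in\mathbb{Z}$. Let $\mathrm{sg}(r)=1$ if $r\ge 0$, $\mathrm{sg}(r)=-1$ if $r<0$, and $\mathrm{sg}(r,s)=\frac{\mathrm{sg}(r)+\mathrm{sg}(s)}{2}$. For positive integers $a,b,c$ put $$f_{a,b,c}(x,y;q)=\sum_{r,s\in\mathbb{Z}}\mathrm{sg}(r,s)(-1)^{r+s}x^ry^sq^{a\binom r2+brs+c\binom s2}.$$ Define $$k_{t,m}(x;q)=\Big(\sum_{r,s\ge 0}-\sum_{r,s<0}\Big)\frac{(-1)^{r+s}q^{2\binom r2+2trs+\binom s2+2tr+2ms}}{1-xq^{2r+1}},$$ $$\overline{k}_{t,m}(x;q)=\frac{x}{1+x}\Big(\frac1x k_{t,m}(-1;q)+k_{t,m}(x;q)\Big),\qquad \mathcal{V}_t^{(m)}(x;q)=\frac{\overline{k}_{t,m}(x;q)}{(q)_\infty(q^2;q^2)_\infty}.$$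 **Theorem.** Let $x\in\mathbb{C}$ be generic, that is, $x\ne 0$, $x\neq -1$ and $x\ne q^{2n+1}$ for all $n\in\mathbb{Z}$. Then the double series defining $k_{t,m}(-1;q)$, $k_{t,m}(x;q)$ and the functions $f_{a,b,c}$ below converge absolutely, the numbers $(q)_\infty$, $(q^2;q^2)_\infty$, $\Theta(-q;q^2)$ and $\Theta(qx;q^2)$ are non-zero, and $$\begin{aligned}\mathcal{V}_t^{(m)}(x;q)={}&\frac{x\,q^{-2t^2+3t-4tm}}{(1+x)(q)_\infty(q^2;q^2)_\infty}\sum_{k=0}^{2t^2-2}(-1)^{k+1}q^{k^2+3k}f_{2,2t,1}\big(q^{2t+2-4t^2+2k},q^{2m};q\big)\\&\times\Bigg(\frac{x^{-1}}{\Theta(-q;q^2)}f_{2,4t^2-2,4t^2(2t^2-1)}\big(-q^{2k+1},-q^{4t^2k-2+3t-4tm+4t^4};q\big)\\&\qquad+\frac{1}{\Theta(qx;q^2)}f_{2,4t^2-2,4t^2(2t^2-1)}\big(x^{-1}q^{2k+1},-q^{4t^2k-2+3t-4tm+4t^4};q\big)\Bigg).\end{aligned}$$ -/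

import Mathlib

noncomputable section

namespace UnimodalSeries

/-- The infinite `q`-Pochhammer symbol `(a; q)_∞ = ∏_{n ≥ 0} (1 - a q^n)`. -/
def qPoch (a q : ℂ) : ℂ := ∏' n : ℕ, (1 - a * q ^ n)

/-- For `|q| < 1` the product defining `(a; q)_∞` converges. -/
theorem multipliable_qPoch (a : ℂ) {q : ℂ} (hq : ‖q‖ < 1) :
    Multipliable fun n : ℕ => 1 - a * q ^ n := by
  have h : Summable fun n : ℕ => ‖-(a * q ^ n)‖ := by
    simpa [norm_mul, norm_pow] using
      (summable_geometric_of_lt_one (norm_nonneg q) hq).mul_left ‖a‖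
  simpa [sub_eq_add_neg] using multipliable_one_add_of_summable h

/-- The theta function `Θ(x; q) = (x; q)_∞ (q/x; q)_∞ (q; q)_∞`. -/
def Theta (x q : ℂ) : ℂ := qPoch x q * qPoch (q / x) q * qPoch q q

/-- The binomial coefficient `binom(r, 2) = r (r - 1) / 2` of an arbitrary integer `r`
(the division is exact). -/
def binom2 (r : ℤ) : ℤ := r * (r - 1) / 2

theorem two_mul_binom2 (r : ℤ) : 2 * binom2 r = r * (r - 1) :=
  Int.mul_ediv_cancel' (Int.even_mul_pred_self r).two_dvd

/-- `sg(r)` is `1` for `r ≥ 0` and `-1` for `r < 0`. -/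
def sg (r : ℤ) : ℂ := if 0 ≤ r then 1 else -1

/-- `sg(r, s) = (sg(r) + sg(s)) / 2`. -/
def sg2 (r s : ℤ) : ℂ := (sg r + sg s) / 2

/-- The term of index `(r, s)` of the Hecke-type double sum `f_{a,b,c}(x, y; q)`. -/
def heckeTerm (a b c : ℤ) (x y q : ℂ) (p : ℤ × ℤ) : ℂ :=
  sg2 p.1 p.2 * (-1) ^ (p.1 + p.2) * x ^ p.1 * y ^ p.2 *
    q ^ (a * binom2 p.1 + b * p.1 * p.2 + c * binom2 p.2)

/-- The Hecke-type double sum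
`f_{a,b,c}(x, y; q) = ∑_{r,s ∈ ℤ} sg(r,s) (-1)^{r+s} x^r y^s q^{a binom(r,2) + b r s + c binom(s,2)}`. -/
def hecke (a b c : ℤ) (x y q : ℂ) : ℂ := ∑' p : ℤ × ℤ, heckeTerm a b c x y q p

/-- The index set `r, s ≥ 0`. -/
def nonnegQuadrant : Set (ℤ × ℤ) := {p | 0 ≤ p.1 ∧ 0 ≤ p.2}

/-- The index set `r, s < 0`. -/
def negQuadrant : Set (ℤ × ℤ) := {p | p.1 < 0 ∧ p.2 < 0}

/-- The term of index `(r, s)` of `k_{t,m}(x; q)`. -/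
def kTerm (t m : ℤ) (x q : ℂ) (p : ℤ × ℤ) : ℂ :=
  (-1) ^ (p.1 + p.2) *
    q ^ (2 * binom2 p.1 + 2 * t * p.1 * p.2 + binom2 p.2 + 2 * t * p.1 + 2 * m * p.2) /
      (1 - x * q ^ (2 * p.1 + 1))

/-- Both double series (over `r, s ≥ 0` and over `r, s < 0`) in `k_{t,m}(x; q)` converge
absolutely. -/
def KConverges (t m : ℤ) (x q : ℂ) : Prop :=
  Summable (fun p : nonnegQuadrant => kTerm t m x q p) ∧
    Summable (fun p : negQuadrant => kTerm t m x q p)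

/-- `k_{t,m}(x; q)`, the sum over `r, s ≥ 0` minus the sum over `r, s < 0`. -/
def k (t m : ℤ) (x q : ℂ) : ℂ :=
  ∑' p : nonnegQuadrant, kTerm t m x q p - ∑' p : negQuadrant, kTerm t m x q p

/-- `k̄_{t,m}(x; q) = x / (1 + x) * (k_{t,m}(-1; q) / x + k_{t,m}(x; q))`. -/
def kBar (t m : ℤ) (x q : ℂ) : ℂ :=
  x / (1 + x) * (1 / x * k t m (-1) q + k t m x q)

/-- `𝒱_t^{(m)}(x; q) = k̄_{t,m}(x; q) / ((q; q)_∞ (q²; q²)_∞)`. -/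
def V (t m : ℤ) (x q : ℂ) : ℂ :=
  1 / (qPoch q q * qPoch (q ^ 2) (q ^ 2)) * kBar t m x q

end UnimodalSeries

end

/-!
Since `V` is linear in the values of `k`, it suffices to show, for generic `x`, that
`Θ(q x; q²) k_{t,m}(x; q)` equals `q ^ D` times a finite sum of products of two Hecke-type sums,
where `D = -2 t² + 3 t - 4 t m`; the claim is the combination of the cases `x` and `-1`.

Both sides are evaluations of one quadruple series `quadTerm`, indexed by `((ρ, i), (r, s))`.

* Summing over `(ρ, i)` first uses the partial fraction identity `hecke_two_two_two_mul`,
  `Θ(q x; q²) / (1 - x q ^ (2 r + 1)) = f_{2,2,2}(q / x, q ^ (2 r + 2); q)`,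
  and gives `Θ(q x; q²) k_{t,m}(x; q)`.
* Summing over `(r, s)` first gives `∑ sg(ρ, i) (-1) ^ (ρ + i) x ^ (-ρ) q ^ ((ρ + i)² + i) F i` with
  `F i = f_{2,2t,1}(q ^ (2 t + 2 i), q ^ (2 m); q)`. The functional equation of Hecke-type sums
  relates `F i` to `F (i - N)`, `N = 2 t² - 1` (`hecke_zpow_recursion`), and its theta-function
  corrections vanish because they are theta functions at integral powers of their nomes. Hence
  `F (κ + N s)` is an explicit multiple of `F (κ - N)`; splitting `i = κ + N s` with `0 ≤ κ < N`
  turns the sum over `(ρ, s)` into `f_{2,4t²-2,4t²(2t²-1)}`.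

The sign `sg(ρ, i)` is what makes the quadruple series converge absolutely (`summable_quadTerm`).
The value of `f_{2,2,2}` follows from the same functional equation together with the Jacobi triple
product `theta_eq_tsum`, which is proved here as the limit of its finite form.
-/

namespace UnimodalSeries

/-! ### Summability -/

theorem binom2_add_one (n : ℤ) : binom2 (n + 1) = binom2 n + n := by
  have h1 := two_mul_binom2 n
  have h2 := two_mul_binom2 (n + 1)
  linarith

theorem binom2_neg (n : ℤ) : binom2 (-n) = binom2 n + n := by
  have h1 := two_mul_binom2 n
  have h2 := two_mul_binom2 (-n)
  linarith

theorem summable_nat_zpow_binom2 {p y : ℝ} (hp0 : 0 < p) (hp1 : p < 1) (hy : 0 < y) :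
    Summable fun n : ℕ => y ^ (n : ℤ) * p ^ binom2 n := by
  refine summable_of_ratio_test_tendsto_lt_one (l := 0) one_pos
    (Filter.Eventually.of_forall fun n => by positivity) ?_
  have h : Filter.Tendsto (fun n : ℕ => y * p ^ n) Filter.atTop (nhds (y * 0)) :=
    (tendsto_pow_atTop_nhds_zero_of_lt_one hp0.le hp1).const_mul y
  rw [mul_zero] at h
  refine h.congr fun n => ?_
  have h1 : ∀ n : ℕ, 0 < y ^ (n : ℤ) * p ^ binom2 n := fun n => by positivity
  rw [Real.norm_of_nonneg (h1 _).le, Real.norm_of_nonneg (h1 _).le, eq_div_iff (h1 n).ne']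
  push_cast
  rw [binom2_add_one, zpow_add₀ hy.ne', zpow_add₀ hp0.ne', zpow_one, zpow_natCast p n]
  ring

theorem summable_zpow_binom2 {p y : ℝ} (hp0 : 0 < p) (hp1 : p < 1) (hy : 0 < y) :
    Summable fun n : ℤ => y ^ n * p ^ binom2 n := by
  refine Summable.of_nat_of_neg (summable_nat_zpow_binom2 hp0 hp1 hy) ?_
  refine (summable_nat_zpow_binom2 hp0 hp1 (div_pos hp0 hy)).congr fun n => ?_
  rw [binom2_neg, zpow_add₀ hp0.ne', div_zpow, zpow_neg]
  field_simp

theorem summable_zpow_mul_binom2 {p y : ℝ} (hp0 : 0 < p) (hp1 : p < 1) (hy : 0 < y) {a : ℤ}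
    (ha : 0 < a) : Summable fun n : ℤ => y ^ n * p ^ (a * binom2 n) := by
  have := summable_zpow_binom2 (p := p ^ a) (zpow_pos hp0 a) (zpow_lt_one₀ hp0 hp1 ha) hy
  simpa only [zpow_mul] using this

theorem summable_zpow_abs {p : ℝ} (hp0 : 0 < p) (hp1 : p < 1) :
    Summable fun n : ℤ => p ^ |n| := by
  have h := summable_geometric_of_lt_one hp0.le hp1
  exact Summable.of_nat_of_neg (h.congr fun n => by simp) (h.congr fun n => by simp)

theorem norm_sg2_le (r s : ℤ) : ‖sg2 r s‖ ≤ 1 := by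
  unfold sg2 sg
  split_ifs <;> norm_num

theorem sg2_eq_zero_or (r s : ℤ) : sg2 r s = 0 ∨ (0 ≤ r ∧ 0 ≤ s) ∨ (r < 0 ∧ s < 0) := by
  unfold sg2 sg
  split_ifs <;> norm_num <;> omega

/-- The monomial of index `(r, s)` of the double sum `hecke`, without the sign `sg2 r s`. -/
noncomputable def heckeMon (a b c : ℤ) (x y q : ℂ) (p : ℤ × ℤ) : ℂ :=
  (-1) ^ (p.1 + p.2) * x ^ p.1 * y ^ p.2 *
    q ^ (a * binom2 p.1 + b * p.1 * p.2 + c * binom2 p.2)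

theorem heckeTerm_eq (a b c : ℤ) (x y q : ℂ) (p : ℤ × ℤ) :
    heckeTerm a b c x y q p = sg2 p.1 p.2 * heckeMon a b c x y q p := by
  unfold heckeTerm heckeMon
  ring

theorem norm_heckeMon (a b c : ℤ) (x y q : ℂ) (p : ℤ × ℤ) :
    ‖heckeMon a b c x y q p‖ = ‖x‖ ^ p.1 * ‖y‖ ^ p.2 *
      ‖q‖ ^ (a * binom2 p.1 + b * p.1 * p.2 + c * binom2 p.2) := by
  simp [heckeMon, norm_zpow]

theorem summable_heckeTerm {a b c : ℤ} (ha : 0 < a) (hb : 0 ≤ b) (hc : 0 < c) {x y q : ℂ}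
    (hx : x ≠ 0) (hy : y ≠ 0) (hq0 : q ≠ 0) (hq1 : ‖q‖ < 1) :
    Summable (heckeTerm a b c x y q) := by
  have hq : 0 < ‖q‖ := norm_pos_iff.2 hq0
  have h := (summable_zpow_mul_binom2 hq hq1 (norm_pos_iff.2 hx) ha).mul_of_nonneg
    (summable_zpow_mul_binom2 hq hq1 (norm_pos_iff.2 hy) hc)
    (fun n => by positivity) (fun n => by positivity)
  refine Summable.of_norm_bounded h fun p => ?_
  rw [heckeTerm_eq, norm_mul]
  rcases sg2_eq_zero_or p.1 p.2 with h0 | h0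
  · rw [h0, norm_zero, zero_mul]
    positivity
  have hrs : 0 ≤ b * p.1 * p.2 := by
    rw [mul_assoc]
    exact mul_nonneg hb (h0.elim (fun h => mul_nonneg h.1 h.2)
      fun h => (mul_pos_of_neg_of_neg h.1 h.2).le)
  have hle : ‖q‖ ^ (b * p.1 * p.2) ≤ 1 := zpow_le_one₀ hq hq1.le hrs
  calc ‖sg2 p.1 p.2‖ * ‖heckeMon a b c x y q p‖
      ≤ 1 * ‖heckeMon a b c x y q p‖ := by
        gcongr
        exact norm_sg2_le _ _
    _ = (‖x‖ ^ p.1 * ‖q‖ ^ (a * binom2 p.1)) * (‖y‖ ^ p.2 * ‖q‖ ^ (c * binom2 p.2)) *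
        ‖q‖ ^ (b * p.1 * p.2) := by
        rw [norm_heckeMon, zpow_add₀ hq.ne', zpow_add₀ hq.ne']
        ring
    _ ≤ _ := mul_le_of_le_one_right (by positivity) hle

theorem summable_theta {x q : ℂ} (hx : x ≠ 0) (hq0 : q ≠ 0) (hq1 : ‖q‖ < 1) {a : ℤ}
    (ha : 0 < a) : Summable fun n : ℤ => (-1) ^ n * x ^ n * q ^ (a * binom2 n) := by
  refine Summable.of_norm_bounded (summable_zpow_mul_binom2 (norm_pos_iff.2 hq0) hq1
    (norm_pos_iff.2 hx) ha) fun n => ?_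
  simp [norm_zpow]

/-! ### The Jacobi triple product -/

theorem qPoch_ne_zero {a q : ℂ} (hq1 : ‖q‖ < 1) (h : ∀ n : ℕ, a * q ^ n ≠ 1) :
    qPoch a q ≠ 0 := by
  have hs : Summable fun n : ℕ => ‖-(a * q ^ n)‖ := by
    simpa [norm_mul, norm_pow] using
      (summable_geometric_of_lt_one (norm_nonneg q) hq1).mul_left ‖a‖
  have := tprod_one_add_ne_zero_of_summable (f := fun n : ℕ => -(a * q ^ n))
    (fun n => by
      rw [← sub_eq_add_neg]
      exact sub_ne_zero.2 (h n).symm) hs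
  simpa [qPoch, sub_eq_add_neg] using this

theorem pow_ne_one_of_norm_lt_one {q : ℂ} (hq1 : ‖q‖ < 1) {n : ℕ} (hn : n ≠ 0) : q ^ n ≠ 1 := by
  intro h
  have := pow_lt_one₀ (norm_nonneg q) hq1 hn
  rw [← norm_pow, h, norm_one] at this
  exact lt_irrefl _ this

theorem qPoch_self_ne_zero {q : ℂ} (hq1 : ‖q‖ < 1) : qPoch q q ≠ 0 :=
  qPoch_ne_zero hq1 fun n => by
    rw [← pow_succ']
    exact pow_ne_one_of_norm_lt_one hq1 n.succ_ne_zero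

/-- The finite product `(a; q)_n`. -/
noncomputable def qPochFin (a q : ℂ) (n : ℕ) : ℂ := ∏ j ∈ Finset.range n, (1 - a * q ^ j)

theorem tendsto_qPochFin (a : ℂ) {q : ℂ} (hq : ‖q‖ < 1) :
    Filter.Tendsto (qPochFin a q) Filter.atTop (nhds (qPoch a q)) :=
  (multipliable_qPoch a hq).hasProd.tendsto_prod_nat

/-- `1 / (q; q)_m`, extended by `0` to `m < 0`, so that
`recipFactorial_sub_one` holds for every integer `m`. -/
noncomputable def recipFactorial (q : ℂ) (m : ℤ) : ℂ :=
  if m < 0 then 0 else (qPochFin q q m.toNat)⁻¹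

theorem recipFactorial_natCast (q : ℂ) (n : ℕ) :
    recipFactorial q n = (qPochFin q q n)⁻¹ := by
  simp [recipFactorial]

theorem recipFactorial_sub_one {q : ℂ} (hq1 : ‖q‖ < 1) (m : ℤ) :
    recipFactorial q (m - 1) = (1 - q ^ m) * recipFactorial q m := by
  rcases lt_trichotomy m 0 with h | rfl | h
  · simp [recipFactorial, h, show m - 1 < 0 by omega]
  · simp [recipFactorial]
  · obtain ⟨n, rfl⟩ : ∃ n : ℕ, m = (n + 1 : ℕ) := ⟨(m - 1).toNat, by omega⟩
    have h1 : (1 : ℂ) - q ^ (n + 1) ≠ 0 :=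
      sub_ne_zero.2 (pow_ne_one_of_norm_lt_one hq1 n.succ_ne_zero).symm
    rw [show ((n + 1 : ℕ) : ℤ) - 1 = (n : ℕ) by push_cast; ring, recipFactorial_natCast,
      recipFactorial_natCast, zpow_natCast, qPochFin, qPochFin, Finset.prod_range_succ, ← pow_succ',
      mul_inv, mul_left_comm, mul_inv_cancel₀ h1, mul_one]

theorem tendsto_recipFactorial {q : ℂ} (hq1 : ‖q‖ < 1) :
    Filter.Tendsto (fun n : ℕ => recipFactorial q n) Filter.atTop (nhds (qPoch q q)⁻¹) := by
  simp only [recipFactorial_natCast]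
  exact (tendsto_qPochFin q hq1).inv₀ (qPoch_self_ne_zero hq1)

theorem exists_norm_recipFactorial_le {q : ℂ} (hq1 : ‖q‖ < 1) :
    ∃ C, 0 ≤ C ∧ ∀ m, ‖recipFactorial q m‖ ≤ C := by
  obtain ⟨C, hC⟩ := (Metric.isBounded_range_of_tendsto _
    (tendsto_recipFactorial hq1)).exists_norm_le
  refine ⟨C, (norm_nonneg _).trans (hC _ ⟨0, rfl⟩), fun m => ?_⟩
  rcases lt_or_ge m 0 with h | h
  · rw [recipFactorial, if_pos h, norm_zero]
    exact (norm_nonneg _).trans (hC _ ⟨0, rfl⟩)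
  · lift m to ℕ using h
    exact hC _ ⟨m, rfl⟩

/-- The coefficient of `x ^ k` in `(q x; q²)_n (q / x; q²)_n`. -/
noncomputable def jacobiCoeff (q : ℂ) (n : ℕ) (k : ℤ) : ℂ :=
  (-1) ^ k * q ^ k ^ 2 * qPochFin (q ^ 2) (q ^ 2) (2 * n) *
    (recipFactorial (q ^ 2) (n - k) * recipFactorial (q ^ 2) (n + k))

/-- Multiplying by `(1 - x q ^ (2 n + 1)) (1 - x⁻¹ q ^ (2 n + 1))` acts on coefficients by this
three-term recurrence. -/
theorem jacobiCoeff_succ {q : ℂ} (hq0 : q ≠ 0) (hq1 : ‖q ^ 2‖ < 1) (n : ℕ) (k : ℤ) :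
    jacobiCoeff q (n + 1) k = (1 + q ^ (4 * n + 2)) * jacobiCoeff q n k -
      q ^ (2 * n + 1) * (jacobiCoeff q n (k - 1) + jacobiCoeff q n (k + 1)) := by
  have e1 := recipFactorial_sub_one hq1 (n + 1 - k)
  have e2 := recipFactorial_sub_one hq1 (n + 1 + k)
  have e3 := recipFactorial_sub_one hq1 (n - k)
  have e4 := recipFactorial_sub_one hq1 (n + k)
  rw [show (n : ℤ) + 1 - k - 1 = n - k by ring] at e1
  rw [show (n : ℤ) + 1 + k - 1 = n + k by ring] at e2
  rw [show (n : ℤ) - k - 1 = n - (k + 1) by ring] at e3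
  rw [show (n : ℤ) + k - 1 = n + (k - 1) by ring] at e4
  have s1 : ((-1 : ℂ)) ^ (k - 1) = -(-1) ^ k := by rw [zpow_sub_one₀ (by norm_num)]; norm_num
  have s2 : ((-1 : ℂ)) ^ (k + 1) = -(-1) ^ k := by rw [zpow_add_one₀ (by norm_num)]; norm_num
  unfold jacobiCoeff
  rw [e3, e4, e1, e2, s1, s2]
  rw [show (n : ℤ) - (k - 1) = n + 1 - k by ring, show (n : ℤ) + (k + 1) = n + 1 + k by ring]
  push_cast
  have hQ : ∀ j : ℤ, (q ^ 2) ^ j = (q ^ j) ^ 2 := fun j => by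
    rw [← zpow_natCast, ← zpow_natCast, ← zpow_mul, ← zpow_mul, mul_comm]
  have p1 : q ^ (k - 1) ^ 2 = q ^ k ^ 2 * (q ^ k)⁻¹ ^ 2 * q := by
    rw [show (k - 1) ^ 2 = k ^ 2 + (-k) + (-k) + 1 by ring]
    simp only [zpow_add₀ hq0, zpow_neg, zpow_one]; ring
  have p2 : q ^ (k + 1) ^ 2 = q ^ k ^ 2 * (q ^ k) ^ 2 * q := by
    rw [show (k + 1) ^ 2 = k ^ 2 + k + k + 1 by ring]
    simp only [zpow_add₀ hq0, zpow_one]; ring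
  have p3 : qPochFin (q ^ 2) (q ^ 2) (2 * (n + 1)) = qPochFin (q ^ 2) (q ^ 2) (2 * n) *
      (1 - q ^ 2 * (q ^ 2) ^ (2 * n)) * (1 - q ^ 2 * (q ^ 2) ^ (2 * n + 1)) := by
    simp only [qPochFin, mul_add, mul_one]
    rw [Finset.prod_range_succ, Finset.prod_range_succ]
  rw [p1, p2, p3]
  simp only [hQ, zpow_add₀ hq0, zpow_sub₀ hq0, zpow_one, zpow_natCast]
  have hk := zpow_ne_zero k hq0
  generalize q ^ k = K at *
  generalize recipFactorial (q ^ 2) _ = u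
  generalize recipFactorial (q ^ 2) _ = v
  rw [show q ^ (4 * n + 2) = (q ^ n) ^ 4 * q ^ 2 by ring,
    show q ^ (2 * n + 1) = (q ^ n) ^ 2 * q by ring,
    show (q ^ 2) ^ (2 * n) = (q ^ n) ^ 4 by ring,
    show (q ^ 2) ^ (2 * n + 1) = (q ^ n) ^ 4 * q ^ 2 by ring]
  generalize q ^ n = A
  field_simp
  ring

/-- The finite Jacobi triple product; the coefficients vanish for `|k| > n`. -/
theorem hasSum_jacobiCoeff {q x : ℂ} (hq0 : q ≠ 0) (hq1 : ‖q ^ 2‖ < 1) (hx : x ≠ 0) (n : ℕ) :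
    HasSum (fun k : ℤ => jacobiCoeff q n k * x ^ k)
      (qPochFin (q * x) (q ^ 2) n * qPochFin (q / x) (q ^ 2) n) := by
  induction n with
  | zero =>
    convert hasSum_single (0 : ℤ) fun k hk => ?_ using 1
    · simp [jacobiCoeff, qPochFin, recipFactorial]
    · rcases lt_or_gt_of_ne hk with h | h <;> simp [jacobiCoeff, recipFactorial, h]
  | succ n ih =>
    have h1 : HasSum (fun k : ℤ => jacobiCoeff q n (k - 1) * x ^ k) _ :=
      (((Equiv.subRight (1 : ℤ)).hasSum_iff.2 ih).mul_left x).congr_fun fun k => by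
        simp [zpow_sub_one₀ hx]; field_simp
    have h2 : HasSum (fun k : ℤ => jacobiCoeff q n (k + 1) * x ^ k) _ :=
      (((Equiv.addRight (1 : ℤ)).hasSum_iff.2 ih).mul_left x⁻¹).congr_fun fun k => by
        simp [zpow_add_one₀ hx]; field_simp
    have h3 := (ih.mul_left (1 + q ^ (4 * n + 2))).sub ((h1.add h2).mul_left (q ^ (2 * n + 1)))
    have e : qPochFin (q * x) (q ^ 2) (n + 1) * qPochFin (q / x) (q ^ 2) (n + 1) =
        (1 + q ^ (4 * n + 2)) * (qPochFin (q * x) (q ^ 2) n * qPochFin (q / x) (q ^ 2) n) -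
          q ^ (2 * n + 1) *
            (x * (qPochFin (q * x) (q ^ 2) n * qPochFin (q / x) (q ^ 2) n) +
              x⁻¹ * (qPochFin (q * x) (q ^ 2) n * qPochFin (q / x) (q ^ 2) n)) := by
      unfold qPochFin
      rw [Finset.prod_range_succ, Finset.prod_range_succ, show (q ^ 2) ^ n = (q ^ n) ^ 2 by ring]
      field_simp
      ring
    rw [e]
    refine h3.congr_fun fun k => ?_
    rw [jacobiCoeff_succ hq0 hq1]
    ring

/-- The Jacobi triple product, obtained from `hasSum_jacobiCoeff` by dominated convergence. -/
theorem theta_eq_tsum {q x : ℂ} (hq0 : q ≠ 0) (hq1 : ‖q‖ < 1) (hx : x ≠ 0) :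
    Theta (q * x) (q ^ 2) = ∑' n : ℤ, (-1) ^ n * x ^ n * q ^ n ^ 2 := by
  have hQ : ‖q ^ 2‖ < 1 := by
    rw [norm_pow]
    exact pow_lt_one₀ (norm_nonneg _) hq1 two_ne_zero
  obtain ⟨C, hC0, hC⟩ := exists_norm_recipFactorial_le hQ
  obtain ⟨D, hD⟩ := (Metric.isBounded_range_of_tendsto _
    (tendsto_qPochFin (q ^ 2) hQ)).exists_norm_le
  have hne := qPoch_self_ne_zero hQ
  have hlim : Filter.Tendsto (fun n : ℕ => ∑' k : ℤ, jacobiCoeff q n k * x ^ k) Filter.atTop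
      (nhds (∑' k : ℤ, ((-1) ^ k * x ^ k * q ^ k ^ 2) * (qPoch (q ^ 2) (q ^ 2))⁻¹)) := by
    refine tendsto_tsum_of_dominated_convergence
      (bound := fun k : ℤ => ‖(-1) ^ k * (q * x) ^ k * q ^ (2 * binom2 k)‖ * (D * (C * C)))
      ((summable_theta (mul_ne_zero hq0 hx) hq0 hq1 two_pos).norm.mul_right _) (fun k => ?_)
      (Filter.Eventually.of_forall fun n k => ?_)
    · have t1 : Filter.Tendsto (fun n : ℕ => recipFactorial (q ^ 2) (n - k)) Filter.atTop
          (nhds (qPoch (q ^ 2) (q ^ 2))⁻¹) := by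
        have ht : Filter.Tendsto (fun n : ℕ => (n - k : ℤ).toNat) Filter.atTop Filter.atTop :=
          Filter.tendsto_atTop_atTop.2 fun b => ⟨(b + k).toNat, fun a ha => by omega⟩
        refine ((tendsto_recipFactorial hQ).comp ht).congr' ?_
        filter_upwards [Filter.eventually_ge_atTop k.toNat] with n hn
        simp only [Function.comp]
        congr 1
        omega
      have t2 : Filter.Tendsto (fun n : ℕ => recipFactorial (q ^ 2) (n + k)) Filter.atTop
          (nhds (qPoch (q ^ 2) (q ^ 2))⁻¹) := by
        have ht : Filter.Tendsto (fun n : ℕ => (n + k : ℤ).toNat) Filter.atTop Filter.atTop :=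
          Filter.tendsto_atTop_atTop.2 fun b => ⟨(b - k).toNat, fun a ha => by omega⟩
        refine ((tendsto_recipFactorial hQ).comp ht).congr' ?_
        filter_upwards [Filter.eventually_ge_atTop (-k).toNat] with n hn
        simp only [Function.comp]
        congr 1
        omega
      have t3 : Filter.Tendsto (fun n : ℕ => qPochFin (q ^ 2) (q ^ 2) (2 * n)) Filter.atTop
          (nhds (qPoch (q ^ 2) (q ^ 2))) :=
        (tendsto_qPochFin (q ^ 2) hQ).comp
          (Filter.tendsto_id.const_mul_atTop' (two_pos : 0 < 2))
      have t4 := ((t3.const_mul ((-1) ^ k * q ^ k ^ 2)).mul (t1.mul t2)).mul_const (x ^ k)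
      rw [show (-1) ^ k * x ^ k * q ^ k ^ 2 * (qPoch (q ^ 2) (q ^ 2))⁻¹ =
          (-1) ^ k * q ^ k ^ 2 * qPoch (q ^ 2) (q ^ 2) *
            ((qPoch (q ^ 2) (q ^ 2))⁻¹ * (qPoch (q ^ 2) (q ^ 2))⁻¹) * x ^ k by field_simp]
      exact t4
    · have e : (-1) ^ k * (q * x) ^ k * q ^ (2 * binom2 k) = (-1) ^ k * x ^ k * q ^ k ^ 2 := by
        rw [two_mul_binom2, show k ^ 2 = k + k * (k - 1) by ring, zpow_add₀ hq0 k, mul_zpow]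
        ring
      rw [e, jacobiCoeff]
      calc _ = ‖(-1) ^ k * x ^ k * q ^ k ^ 2‖ * (‖qPochFin (q ^ 2) (q ^ 2) (2 * n)‖ *
            (‖recipFactorial (q ^ 2) (n - k)‖ * ‖recipFactorial (q ^ 2) (n + k)‖)) := by
            simp only [norm_mul]
            ring
        _ ≤ _ := by
            gcongr
            · exact (norm_nonneg _).trans (hD _ ⟨0, rfl⟩)
            · exact hD _ ⟨_, rfl⟩
            · exact hC _
            · exact hC _
  have hlim2 := (tendsto_qPochFin (q * x) hQ).mul (tendsto_qPochFin (q / x) hQ)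
  have := tendsto_nhds_unique hlim2 (hlim.congr fun n => (hasSum_jacobiCoeff hq0 hQ hx n).tsum_eq)
  rw [tsum_mul_right] at this
  rw [Theta, show q ^ 2 / (q * x) = q / x by field_simp, this, inv_mul_cancel_right₀ hne]

/-! ### Functional equations of Hecke-type double sums -/

/-- No summability is needed: the sum of a divergent series is the junk value `0`. -/
theorem tsum_eq_zero_of_reflect {F : ℤ → ℂ} (c : ℤ) (h : ∀ n, F (c - n) = -F n) :
    ∑' n, F n = 0 := by
  have h1 : ∑' n, F (c - n) = ∑' n, F n := (Equiv.subLeft c).tsum_eq F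
  rw [tsum_congr h, tsum_neg] at h1
  exact self_eq_neg.1 h1.symm

theorem neg_one_zpow_congr {a b : ℤ} (c : ℤ) (h : a = b + 2 * c) : (-1 : ℂ) ^ a = (-1) ^ b := by
  rw [h, zpow_add₀ (by norm_num), zpow_mul]
  norm_num

theorem neg_one_zpow_congr_neg {a b : ℤ} (c : ℤ) (h : a = b + 1 + 2 * c) :
    (-1 : ℂ) ^ a = -(-1) ^ b := by
  rw [neg_one_zpow_congr c h, zpow_add_one₀ (by norm_num)]
  norm_num

/-- `Θ(Q ^ e; Q) = 0` for `Q = q ^ a` and every integer `e`. -/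
theorem tsum_theta_zpow_eq_zero {q : ℂ} (hq0 : q ≠ 0) (a e : ℤ) :
    ∑' n : ℤ, (-1) ^ n * (q ^ (a * e)) ^ n * q ^ (a * binom2 n) = 0 := by
  refine tsum_eq_zero_of_reflect (1 - 2 * e) fun n => ?_
  rw [neg_one_zpow_congr_neg (a := 1 - 2 * e - n) (b := n) (-e - n) (by ring), neg_mul, neg_mul,
    mul_assoc, mul_assoc, ← zpow_mul, ← zpow_mul, ← zpow_add₀ hq0, ← zpow_add₀ hq0]
  congr 3
  have h1 := two_mul_binom2 n
  have h2 := two_mul_binom2 (1 - 2 * e - n)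
  have h3 : binom2 (1 - 2 * e - n) + e * (1 - 2 * e - n) = binom2 n + e * n := by linarith
  linear_combination a * h3

theorem heckeMon_fst_zero (a b c : ℤ) (x y q : ℂ) (s : ℤ) :
    heckeMon a b c x y q (0, s) = (-1) ^ s * y ^ s * q ^ (c * binom2 s) := by
  simp [heckeMon, binom2]

theorem heckeMon_row {q : ℂ} (hq0 : q ≠ 0) (a b c : ℤ) (x y : ℂ) (r s : ℤ) :
    heckeMon a b c x y q (r, s) = ((-1) ^ s * y ^ s * q ^ (c * binom2 s)) *
      ((-1) ^ r * (x * q ^ (b * s)) ^ r * q ^ (a * binom2 r)) := by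
  simp only [heckeMon]
  rw [mul_zpow, ← zpow_mul, zpow_add₀ (by norm_num : (-1 : ℂ) ≠ 0), zpow_add₀ hq0, zpow_add₀ hq0,
    show b * s * r = b * r * s by ring]
  ring

/-- The step `(r, s) ↦ (r + 1, s - k)` multiplies `x` by `q ^ (a - b k)` and `y` by
`q ^ (b - c k)`, up to a constant factor. -/
theorem heckeMon_shift {q : ℂ} (hq0 : q ≠ 0) (a b c : ℤ) {x y : ℂ} (hx : x ≠ 0) (hy : y ≠ 0)
    (k r s : ℤ) :
    heckeMon a b c x y q (r + 1, s - k) =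
      ((-1) ^ (1 - k) * x * y ^ (-k) * q ^ (c * binom2 (-k) - b * k)) *
        heckeMon a b c (x * q ^ (a - b * k)) (y * q ^ (b - c * k)) q (r, s) := by
  simp only [heckeMon]
  have h1 : binom2 (r + 1) = binom2 r + r := binom2_add_one r
  have h2 : binom2 (s - k) = binom2 s + binom2 (-k) - k * s := by
    have e1 := two_mul_binom2 (s - k)
    have e2 := two_mul_binom2 s
    have e3 := two_mul_binom2 (-k)
    linarith
  have h3 : a * binom2 (r + 1) + b * (r + 1) * (s - k) + c * binom2 (s - k) =
      (c * binom2 (-k) - b * k) + (a - b * k) * r + (b - c * k) * s +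
        (a * binom2 r + b * r * s + c * binom2 s) := by
    rw [h1, h2]
    ring
  have h4 : r + 1 + (s - k) = (1 - k) + (r + s) := by ring
  rw [h3, h4, mul_zpow, mul_zpow, ← zpow_mul, ← zpow_mul,
    zpow_add₀ (by norm_num : (-1 : ℂ) ≠ 0) (1 - k),
    zpow_add₀ hq0 _ (a * binom2 r + b * r * s + c * binom2 s), zpow_add₀ hq0 _ ((b - c * k) * s),
    zpow_add₀ hq0 _ ((a - b * k) * r), zpow_add_one₀ hx, sub_eq_add_neg s k, zpow_add₀ hy]
  ring

theorem sg2_sub_sg2_shift (r s : ℤ) {k : ℤ} (hk : 0 ≤ k) :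
    sg2 r s - sg2 (r - 1) (s + k) =
      (if r = 0 then 1 else 0) - (if s ∈ Finset.Ico (-k) 0 then 1 else 0) := by
  have h1 : (0 ≤ r) = (r = 0 ∨ 0 ≤ r - 1) := propext (by omega)
  have h2 : (0 ≤ s + k) = (s ∈ Finset.Ico (-k) 0 ∨ 0 ≤ s) := propext (by
    rw [Finset.mem_Ico]; omega)
  unfold sg2 sg
  simp only [Finset.mem_Ico]
  split_ifs <;> first | omega | norm_num

/-- Shifting the summation index by `(1, -k)` changes the sign `sg2` only on the column `r = 0` and
on the rows `-k ≤ s < 0`. -/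
theorem tsum_sg2_sub_tsum_shift {F : ℤ × ℤ → ℂ} {k : ℤ} (hk : 0 ≤ k)
    (hF : Summable fun p : ℤ × ℤ => sg2 p.1 p.2 * F p)
    (hF' : Summable fun p : ℤ × ℤ => sg2 p.1 p.2 * F (p.1 + 1, p.2 - k))
    (hcol : Summable fun s => F (0, s)) (hrow : ∀ s, Summable fun r => F (r, s)) :
    ∑' p : ℤ × ℤ, sg2 p.1 p.2 * F p - ∑' p : ℤ × ℤ, sg2 p.1 p.2 * F (p.1 + 1, p.2 - k) =
      ∑' s, F (0, s) - ∑ s ∈ Finset.Ico (-k) 0, ∑' r, F (r, s) := by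
  let e : ℤ × ℤ ≃ ℤ × ℤ := (Equiv.subRight (1 : ℤ)).prodCongr (Equiv.addRight k)
  have h2 : HasSum (fun p : ℤ × ℤ => sg2 (p.1 - 1) (p.2 + k) * F p)
      (∑' p : ℤ × ℤ, sg2 p.1 p.2 * F (p.1 + 1, p.2 - k)) := by
    refine (e.hasSum_iff.2 hF'.hasSum).congr_fun fun p => ?_
    simp [e]
  have h3 := hF.hasSum.sub h2
  have hc : HasSum (fun p : ℤ × ℤ => (if p.1 = 0 then 1 else 0) * F p) (∑' s, F (0, s)) := by
    have hi : Function.Injective fun s : ℤ => ((0 : ℤ), s) := fun a b h => by simpa using h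
    refine (hi.hasSum_iff fun p hp => ?_).1 (hcol.hasSum.congr_fun fun s => by simp)
    have : p.1 ≠ 0 := fun h => hp ⟨p.2, by ext <;> simp [h]⟩
    simp [this]
  have hr : HasSum (fun p : ℤ × ℤ => (if p.2 ∈ Finset.Ico (-k) 0 then 1 else 0) * F p)
      (∑ s ∈ Finset.Ico (-k) 0, ∑' r, F (r, s)) := by
    have : ∀ s ∈ Finset.Ico (-k) 0, HasSum (fun p : ℤ × ℤ => (if p.2 = s then 1 else 0) * F p)
        (∑' r, F (r, s)) := fun s _ => by
      have hi : Function.Injective fun r : ℤ => (r, s) := fun a b h => by simpa using h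
      refine (hi.hasSum_iff fun p hp => ?_).1 ((hrow s).hasSum.congr_fun fun s => by simp)
      have : p.2 ≠ s := fun h => hp ⟨p.1, by ext <;> simp [h]⟩
      simp [this]
    refine (hasSum_sum this).congr_fun fun p => ?_
    rw [← Finset.sum_mul, Finset.sum_ite_eq]
  refine h3.unique ((hc.sub hr).congr_fun fun p => ?_)
  rw [← sub_mul, ← sub_mul, sg2_sub_sg2_shift _ _ hk]

/-- The shift `(r, s) ↦ (r + 1, s - k)` of the summation index, with its theta-function corrections. -/
theorem hecke_functional_equation {a b c : ℤ} (ha : 0 < a) (hb : 0 ≤ b) (hc : 0 < c) {x y q : ℂ}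
    (hx : x ≠ 0) (hy : y ≠ 0) (hq0 : q ≠ 0) (hq1 : ‖q‖ < 1) {k : ℤ} (hk : 0 ≤ k) :
    hecke a b c x y q -
        ((-1) ^ (1 - k) * x * y ^ (-k) * q ^ (c * binom2 (-k) - b * k)) *
          hecke a b c (x * q ^ (a - b * k)) (y * q ^ (b - c * k)) q =
      ∑' s : ℤ, (-1) ^ s * y ^ s * q ^ (c * binom2 s) -
        ∑ s ∈ Finset.Ico (-k) 0, ((-1) ^ s * y ^ s * q ^ (c * binom2 s)) *
          ∑' r : ℤ, (-1) ^ r * (x * q ^ (b * s)) ^ r * q ^ (a * binom2 r) := by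
  have hs1 := summable_heckeTerm ha hb hc hx hy hq0 hq1
  have hs2 := summable_heckeTerm ha hb hc (mul_ne_zero hx (zpow_ne_zero (a - b * k) hq0))
    (mul_ne_zero hy (zpow_ne_zero (b - c * k) hq0)) hq0 hq1
  have hrow : ∀ s, Summable fun r : ℤ =>
      (-1) ^ r * (x * q ^ (b * s)) ^ r * q ^ (a * binom2 r) := fun s =>
    summable_theta (mul_ne_zero hx (zpow_ne_zero _ hq0)) hq0 hq1 ha
  have key : ∀ p : ℤ × ℤ, sg2 p.1 p.2 * heckeMon a b c x y q (p.1 + 1, p.2 - k) =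
      ((-1) ^ (1 - k) * x * y ^ (-k) * q ^ (c * binom2 (-k) - b * k)) *
        heckeTerm a b c (x * q ^ (a - b * k)) (y * q ^ (b - c * k)) q p := fun p => by
    rw [heckeTerm_eq, heckeMon_shift hq0 a b c hx hy]
    ring
  have := tsum_sg2_sub_tsum_shift (F := heckeMon a b c x y q) hk
    (hs1.congr fun p => heckeTerm_eq ..)
    ((hs2.mul_left _).congr fun p => (key p).symm)
    ((summable_theta hy hq0 hq1 hc).congr fun s => (heckeMon_fst_zero ..).symm)
    (fun s => ((hrow s).mul_left _).congr fun r => (heckeMon_row hq0 ..).symm)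
  rw [tsum_congr key, tsum_mul_left, tsum_congr fun s => heckeMon_fst_zero a b c x y q s,
    Finset.sum_congr rfl fun s _ =>
      (tsum_congr fun r => heckeMon_row hq0 a b c x y r s).trans tsum_mul_left] at this
  rw [← this, hecke, tsum_congr fun p => heckeTerm_eq a b c x y q p, hecke]

/-- Partial fraction expansion of `Θ(q x; q²) / (1 - x q ^ (2 r + 1))`. -/
theorem hecke_two_two_two_mul {x q : ℂ} (hx : x ≠ 0) (hq0 : q ≠ 0) (hq1 : ‖q‖ < 1) (r : ℤ) :
    hecke 2 2 2 (x⁻¹ * q) (q ^ (2 * r + 2)) q * (1 - x * q ^ (2 * r + 1)) =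
      Theta (q * x) (q ^ 2) := by
  have hz : q ^ (2 * r + 1) ≠ 0 := zpow_ne_zero _ hq0
  have h := hecke_functional_equation (a := 2) (b := 2) (c := 2) two_pos zero_le_two two_pos
    (mul_ne_zero (inv_ne_zero hx) hq0) (zpow_ne_zero (2 * r + 2) hq0) hq0 hq1 (k := 1) zero_le_one
  have h0 := tsum_theta_zpow_eq_zero hq0 2 (r + 1)
  rw [show 2 * (r + 1) = 2 * r + 2 by ring] at h0
  rw [h0, show Finset.Ico (-1 : ℤ) 0 = {-1} by rfl, Finset.sum_singleton] at h
  -- The column `r = 0` vanishes; the single row `s = -1` is the triple product series.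
  have h1 : ∑' n : ℤ, (-1) ^ n * (x⁻¹ * q * q ^ (2 * (-1) : ℤ)) ^ n * q ^ (2 * binom2 n) =
      -(x⁻¹ * Theta (q * x) (q ^ 2) * q⁻¹) := by
    rw [theta_eq_tsum hq0 hq1 hx, ← tsum_mul_left, ← tsum_mul_right, ← tsum_neg,
      ← (Equiv.subLeft (1 : ℤ)).tsum_eq]
    refine tsum_congr fun n => ?_
    simp only [Equiv.subLeft_apply]
    rw [neg_one_zpow_congr_neg (a := 1 - n) (b := n) (-n) (by ring), mul_assoc x⁻¹,
      ← zpow_one_add₀ hq0, mul_zpow, two_mul_binom2, inv_zpow', neg_sub, zpow_sub_one₀ hx,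
      ← zpow_mul]
    have e : q ^ n ^ 2 * q⁻¹ = q ^ ((1 + 2 * -1) * (1 - n)) * q ^ ((1 - n) * (1 - n - 1)) := by
      rw [← zpow_add₀ hq0, ← zpow_sub_one₀ hq0]
      congr 1
      ring
    linear_combination ((-1) ^ n * x ^ n * x⁻¹) * e
  rw [h1] at h
  rw [show binom2 (-1) = 1 by rfl, show (2 : ℤ) * 1 - 2 * 1 = 0 by norm_num,
    show (2 : ℤ) - 2 * 1 = 0 by norm_num, show (1 : ℤ) - 1 = 0 by norm_num,
    show (2 : ℤ) * 1 = 2 by norm_num] at h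
  simp only [zpow_zero, mul_one] at h
  rw [show (2 * r + 2) = (2 * r + 1) + 1 by ring, zpow_add_one₀ hq0 (2 * r + 1)] at h ⊢
  generalize hecke _ _ _ _ _ _ = H at *
  generalize q ^ (2 * r + 1) = z at *
  simp only [zpow_neg, zpow_one] at h
  norm_num at h
  field_simp at h
  rw [mul_comm x q] at h
  linear_combination -h

/-- The boundary theta functions in `hecke_functional_equation` all vanish here, since they are
evaluated at integral powers of their nomes. -/
theorem hecke_zpow_recursion {t m : ℤ} (ht : 1 ≤ t) {q : ℂ} (hq0 : q ≠ 0) (hq1 : ‖q‖ < 1)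
    (i : ℤ) :
    hecke 2 (2 * t) 1 (q ^ (2 * t + 2 * i)) (q ^ (2 * m)) q =
      -q ^ (2 * i + (-2 * t ^ 2 + 3 * t - 4 * t * m)) *
        hecke 2 (2 * t) 1 (q ^ (2 * t + 2 * (i - (2 * t ^ 2 - 1)))) (q ^ (2 * m)) q := by
  have h := hecke_functional_equation (a := 2) (b := 2 * t) (c := 1) two_pos (by omega) one_pos
    (zpow_ne_zero (2 * t + 2 * i) hq0) (zpow_ne_zero (2 * m) hq0) hq0 hq1 (k := 2 * t) (by omega)
  have h1 := tsum_theta_zpow_eq_zero hq0 1 (2 * m)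
  rw [one_mul] at h1
  rw [h1, Finset.sum_eq_zero, sub_zero, sub_eq_zero] at h
  · rw [h, ← zpow_add₀ hq0, ← zpow_add₀ hq0,
      neg_one_zpow_congr_neg (a := 1 - 2 * t) (b := 0) (-t) (by ring), zpow_zero, neg_one_mul,
      ← zpow_mul, neg_mul, neg_mul, ← zpow_add₀ hq0, ← zpow_add₀ hq0,
      show 2 * t + 2 * i + (2 - 2 * t * (2 * t)) = 2 * t + 2 * (i - (2 * t ^ 2 - 1)) by ring,
      show 2 * m + (2 * t - 1 * (2 * t)) = 2 * m by ring]
    have h2 := two_mul_binom2 (-(2 * t))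
    congr 3
    linarith
  · intro s _
    -- Each boundary row is `Θ(q ^ (2 e); q ^ 2)` with `e = t + i + t s`.
    have h2 := tsum_theta_zpow_eq_zero hq0 2 (t + i + t * s)
    rw [← zpow_add₀ hq0, show 2 * t + 2 * i + 2 * t * s = 2 * (t + i + t * s) by ring, h2, mul_zero]

/-- The recursion `hecke_zpow_recursion` iterated `s + 1` times, in either direction. -/
theorem hecke_zpow_residue {t m : ℤ} (ht : 1 ≤ t) {q : ℂ} (hq0 : q ≠ 0) (hq1 : ‖q‖ < 1)
    (κ s : ℤ) :
    hecke 2 (2 * t) 1 (q ^ (2 * t + 2 * (κ + (2 * t ^ 2 - 1) * s))) (q ^ (2 * m)) q =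
      (-1) ^ (s + 1) * q ^ ((s + 1) * (-2 * t ^ 2 + 3 * t - 4 * t * m + 2 * κ) +
        (2 * t ^ 2 - 1) * (s * (s + 1))) *
        hecke 2 (2 * t) 1 (q ^ (2 * t + 2 - 4 * t ^ 2 + 2 * κ)) (q ^ (2 * m)) q := by
  induction s using Int.inductionOn' (b := -1) with
  | zero =>
    rw [show 2 * t + 2 * (κ + (2 * t ^ 2 - 1) * -1) = 2 * t + 2 - 4 * t ^ 2 + 2 * κ by ring]
    simp
  | succ s _ ih =>
    rw [hecke_zpow_recursion ht hq0 hq1, show κ + (2 * t ^ 2 - 1) * (s + 1) - (2 * t ^ 2 - 1) =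
      κ + (2 * t ^ 2 - 1) * s by ring, ih, neg_one_zpow_congr_neg (a := s + 1 + 1) (b := s + 1) 0
      (by ring)]
    have e : q ^ (2 * (κ + (2 * t ^ 2 - 1) * (s + 1)) + (-2 * t ^ 2 + 3 * t - 4 * t * m)) *
        q ^ ((s + 1) * (-2 * t ^ 2 + 3 * t - 4 * t * m + 2 * κ) +
          (2 * t ^ 2 - 1) * (s * (s + 1))) =
        q ^ ((s + 1 + 1) * (-2 * t ^ 2 + 3 * t - 4 * t * m + 2 * κ) +
          (2 * t ^ 2 - 1) * ((s + 1) * (s + 1 + 1))) := by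
      rw [← zpow_add₀ hq0]
      congr 1
      ring
    linear_combination (-(-1) ^ (s + 1) *
      hecke 2 (2 * t) 1 (q ^ (2 * t + 2 - 4 * t ^ 2 + 2 * κ)) (q ^ (2 * m)) q) * e
  | pred s _ ih =>
    rw [hecke_zpow_recursion ht hq0 hq1, show κ + (2 * t ^ 2 - 1) * s - (2 * t ^ 2 - 1) =
      κ + (2 * t ^ 2 - 1) * (s - 1) by ring] at ih
    have hne : -q ^ (2 * (κ + (2 * t ^ 2 - 1) * s) + (-2 * t ^ 2 + 3 * t - 4 * t * m)) ≠ 0 :=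
      neg_ne_zero.2 (zpow_ne_zero _ hq0)
    refine mul_left_cancel₀ hne (ih.trans ?_)
    rw [neg_one_zpow_congr_neg (a := s + 1) (b := s) 0 (by ring), sub_add_cancel]
    have e : q ^ (2 * (κ + (2 * t ^ 2 - 1) * s) + (-2 * t ^ 2 + 3 * t - 4 * t * m)) *
        q ^ (s * (-2 * t ^ 2 + 3 * t - 4 * t * m + 2 * κ) + (2 * t ^ 2 - 1) * ((s - 1) * s)) =
        q ^ ((s + 1) * (-2 * t ^ 2 + 3 * t - 4 * t * m + 2 * κ) +
          (2 * t ^ 2 - 1) * (s * (s + 1))) := by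
      rw [← zpow_add₀ hq0]
      congr 1
      ring
    linear_combination ((-1) ^ s *
      hecke 2 (2 * t) 1 (q ^ (2 * t + 2 - 4 * t ^ 2 + 2 * κ)) (q ^ (2 * m)) q) * e

/-- Splitting the second index by its residue modulo `n`. -/
theorem tsum_eq_sum_tsum_residue {n : ℤ} (hn : 0 < n) {G : ℤ × ℤ → ℂ} (hG : Summable G) :
    ∑' p, G p = ∑ κ ∈ Finset.Icc 0 (n - 1), ∑' p : ℤ × ℤ, G (p.1, κ + n * p.2) := by
  lift n to ℕ using hn.le
  have : NeZero n := ⟨by omega⟩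
  let e : Fin n × (ℤ × ℤ) ≃ ℤ × ℤ := (Equiv.prodComm _ _).trans ((Equiv.prodAssoc _ _ _).trans
    ((Equiv.refl ℤ).prodCongr (Int.divModEquiv n).symm))
  have he : ∀ j p, e (j, p) = (p.1, ((j : ℕ) : ℤ) + n * p.2) := fun j p => by
    simp [e, Int.divModEquiv, mul_comm, add_comm]
  have hs : Summable fun p : Fin n × (ℤ × ℤ) => G (e p) := e.summable_iff.2 hG
  rw [← e.tsum_eq, hs.tsum_prod, tsum_fintype]
  simp only [he]
  refine Finset.sum_nbij (fun j : Fin n => ((j : ℕ) : ℤ)) (fun j _ => ?_) (fun a _ b _ h => ?_)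
    (fun κ hκ => ?_) (fun j _ => rfl)
  · have := j.2
    rw [Finset.mem_Icc]
    omega
  · simpa [Fin.ext_iff] using h
  · rw [Finset.mem_coe, Finset.mem_Icc] at hκ
    exact ⟨⟨κ.toNat, by omega⟩, by simp, by simpa using hκ.1⟩

/-! ### The quadruple sum -/

/-- The quadruple series in `((ρ, i), (r, s))`: the expansion of `Θ(q x; q²) / (1 - x q ^ (2 r + 1))`
as a double series in `(ρ, i)`, times the numerator of index `(r, s)` in `k t m x q`. -/
noncomputable def quadTerm (t m : ℤ) (x q : ℂ) (p : (ℤ × ℤ) × (ℤ × ℤ)) : ℂ :=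
  heckeTerm 2 2 2 (x⁻¹ * q) (q ^ (2 * p.2.1 + 2)) q p.1 *
    heckeTerm 2 (2 * t) 1 (q ^ (2 * t)) (q ^ (2 * m)) q p.2

/-- The exponent bound behind the absolute convergence of the quadruple series: it leaves a product
of one-variable sums. -/
theorem quadTerm_exponent_le {t : ℤ} (ht : 1 ≤ t) {ρ i r s : ℤ}
    (h1 : (0 ≤ ρ ∧ 0 ≤ i) ∨ (ρ < 0 ∧ i < 0)) (h2 : (0 ≤ r ∧ 0 ≤ s) ∨ (r < 0 ∧ s < 0)) :
    |i| + |r| ≤ 2 * ρ * i + (i + r) ^ 2 + i - r + 2 * t * (r * (s + 1)) := by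
  have h3 : 0 ≤ (i + r) ^ 2 := sq_nonneg _
  have h4 : |i| ≤ 2 * ρ * i + i := by
    rcases h1 with ⟨ha, hb⟩ | ⟨ha, hb⟩
    · rw [abs_of_nonneg hb]
      nlinarith
    · rw [abs_of_neg hb]
      nlinarith
  have h5 : |r| ≤ -r + 2 * t * (r * (s + 1)) := by
    rcases h2 with ⟨ha, hb⟩ | ⟨ha, hb⟩
    · rw [abs_of_nonneg ha]
      have : r ≤ r * (s + 1) := by nlinarith
      nlinarith
    · rw [abs_of_neg ha]
      have : 0 ≤ r * (s + 1) := by nlinarith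
      nlinarith
  linarith

theorem summable_quadTerm {t m : ℤ} (ht : 1 ≤ t) {x q : ℂ} (hx : x ≠ 0) (hq0 : q ≠ 0)
    (hq1 : ‖q‖ < 1) : Summable (quadTerm t m x q) := by
  have hq : 0 < ‖q‖ := norm_pos_iff.2 hq0
  have hX : 0 < ‖x⁻¹ * q‖ := norm_pos_iff.2 (mul_ne_zero (inv_ne_zero hx) hq0)
  have hB := ((summable_zpow_mul_binom2 hq hq1 hX two_pos).mul_of_nonneg
    (summable_zpow_abs hq hq1) (fun n => by positivity) (fun n => by positivity)).mul_of_nonneg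
    ((summable_zpow_abs hq hq1).mul_of_nonneg
      (summable_zpow_mul_binom2 hq hq1 (zpow_pos hq (2 * m)) one_pos)
      (fun n => by positivity) (fun n => by positivity))
    (fun n => by positivity) (fun n => by positivity)
  refine Summable.of_norm_bounded hB ?_
  rintro ⟨⟨ρ, i⟩, ⟨r, s⟩⟩
  simp only [quadTerm, heckeTerm_eq, norm_mul]
  rcases sg2_eq_zero_or ρ i with h0 | h1
  · rw [h0, norm_zero]
    simp only [zero_mul]
    positivity
  rcases sg2_eq_zero_or r s with h0 | h2
  · rw [h0, norm_zero]
    simp only [zero_mul, mul_zero]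
    positivity
  have hE := quadTerm_exponent_le ht h1 h2
  have e1 := two_mul_binom2 ρ
  have e2 := two_mul_binom2 i
  have e3 := two_mul_binom2 r
  calc _ ≤ (1 * ‖heckeMon 2 2 2 (x⁻¹ * q) (q ^ (2 * r + 2)) q (ρ, i)‖) *
        (1 * ‖heckeMon 2 (2 * t) 1 (q ^ (2 * t)) (q ^ (2 * m)) q (r, s)‖) := by
        gcongr
        · exact norm_sg2_le _ _
        · exact norm_sg2_le _ _
    _ = ((‖x⁻¹ * q‖ ^ ρ * ‖q‖ ^ (2 * binom2 ρ)) * ((‖q‖ ^ (2 * m)) ^ s * ‖q‖ ^ (1 * binom2 s))) *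
        ‖q‖ ^ (2 * ρ * i + (i + r) ^ 2 + i - r + 2 * t * (r * (s + 1))) := by
        have : 2 * ρ * i + (i + r) ^ 2 + i - r + 2 * t * (r * (s + 1)) =
            (2 * r + 2) * i + (2 * ρ * i + 2 * binom2 i) + 2 * t * r +
              (2 * binom2 r + 2 * t * r * s) := by
          rw [e2, e3]
          ring
        rw [this, norm_heckeMon, norm_heckeMon]
        simp only [norm_zpow, ← zpow_mul]
        simp only [zpow_add₀ hq.ne']
        ring
    _ ≤ ((‖x⁻¹ * q‖ ^ ρ * ‖q‖ ^ (2 * binom2 ρ)) * ((‖q‖ ^ (2 * m)) ^ s * ‖q‖ ^ (1 * binom2 s))) *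
        ‖q‖ ^ (|i| + |r|) := by
        gcongr ?_ * ?_
        exact zpow_le_zpow_right_of_le_one₀ hq hq1.le hE
    _ = _ := by
        rw [zpow_add₀ hq.ne', norm_mul]
        ring

/-- The cross factor `q ^ (2 r i)`, moved from the `(ρ, i)`-sum to the `(r, s)`-sum. -/
theorem quadTerm_eq {q : ℂ} (hq0 : q ≠ 0) (t m : ℤ) (x : ℂ) (p : (ℤ × ℤ) × (ℤ × ℤ)) :
    quadTerm t m x q p = heckeTerm 2 2 2 (x⁻¹ * q) (q ^ (2 : ℤ)) q p.1 *
      heckeTerm 2 (2 * t) 1 (q ^ (2 * t + 2 * p.1.2)) (q ^ (2 * m)) q p.2 := by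
  obtain ⟨⟨ρ, i⟩, ⟨r, s⟩⟩ := p
  simp only [quadTerm, heckeTerm]
  have h1 : (q ^ (2 * r + 2)) ^ i = (q ^ (2 : ℤ)) ^ i * q ^ (2 * i * r) := by
    rw [← zpow_mul, ← zpow_mul, ← zpow_add₀ hq0]
    congr 1
    ring
  have h2 : (q ^ (2 * t + 2 * i)) ^ r = (q ^ (2 * t)) ^ r * q ^ (2 * i * r) := by
    rw [← zpow_mul, ← zpow_mul, ← zpow_add₀ hq0]
    congr 1
    ring
  rw [h1, h2]
  ring

theorem sg2_mul_kTerm {q : ℂ} (hq0 : q ≠ 0) (t m : ℤ) (x : ℂ) (p : ℤ × ℤ) :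
    sg2 p.1 p.2 * kTerm t m x q p =
      heckeTerm 2 (2 * t) 1 (q ^ (2 * t)) (q ^ (2 * m)) q p / (1 - x * q ^ (2 * p.1 + 1)) := by
  rw [heckeTerm, kTerm, ← zpow_mul, ← zpow_mul, zpow_add₀ hq0 _ (2 * m * p.2),
    zpow_add₀ hq0 _ (2 * t * p.1), one_mul]
  ring

theorem indicator_sub_indicator_eq (F : ℤ × ℤ → ℂ) (p : ℤ × ℤ) :
    nonnegQuadrant.indicator F p - negQuadrant.indicator F p = sg2 p.1 p.2 * F p := by
  rcases lt_or_ge p.1 0 with h1 | h1 <;> rcases lt_or_ge p.2 0 with h2 | h2 <;>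
    simp [nonnegQuadrant, negQuadrant, sg2, sg, h1, h2, not_le.2, not_lt.2]

theorem summable_quadrants {F : ℤ × ℤ → ℂ} (h : Summable fun p : ℤ × ℤ => sg2 p.1 p.2 * F p) :
    Summable (nonnegQuadrant.indicator F) ∧ Summable (negQuadrant.indicator F) := by
  constructor
  · refine (h.indicator nonnegQuadrant).congr fun p => ?_
    by_cases hp : p ∈ nonnegQuadrant
    · have h1 : 0 ≤ p.1 := hp.1
      have h2 : 0 ≤ p.2 := hp.2
      simp [hp, sg2, sg, h1, h2]
    · simp [hp]
  · refine (h.indicator negQuadrant).neg.congr fun p => ?_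
    by_cases hp : p ∈ negQuadrant
    · have h1 : ¬ 0 ≤ p.1 := not_le.2 hp.1
      have h2 : ¬ 0 ≤ p.2 := not_le.2 hp.2
      simp [hp, sg2, sg, h1, h2]
    · simp [hp]

theorem Theta_ne_zero {x q : ℂ} (hq0 : q ≠ 0) (hq1 : ‖q‖ < 1) (hx0 : x ≠ 0)
    (hx : ∀ n : ℤ, x ≠ q ^ (2 * n + 1)) : Theta (q * x) (q ^ 2) ≠ 0 := by
  have hQ : ‖q ^ 2‖ < 1 := by
    rw [norm_pow]
    exact pow_lt_one₀ (norm_nonneg _) hq1 two_ne_zero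
  refine mul_ne_zero (mul_ne_zero (qPoch_ne_zero hQ fun n h => ?_)
    (qPoch_ne_zero hQ fun n h => ?_)) (qPoch_self_ne_zero hQ)
  · refine hx (-n - 1) ?_
    rw [show 2 * (-(n : ℤ) - 1) + 1 = -((2 * n + 1 : ℕ) : ℤ) by push_cast; ring, zpow_neg,
      zpow_natCast]
    refine eq_inv_of_mul_eq_one_left ?_
    rw [← h]
    ring
  · refine hx n ?_
    rw [show 2 * (n : ℤ) + 1 = ((2 * n + 1 : ℕ) : ℤ) by push_cast; ring, zpow_natCast]
    rw [show q ^ 2 / (q * x) = q / x by field_simp, div_mul_eq_mul_div, div_eq_one_iff_eq hx0] at h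
    rw [← h]
    ring

/-- Summing the quadruple series over `(ρ, i)` first. The convergence of `k` is read off from that of
the quadruple series, so that no lower bound for `|1 - x q ^ (2 r + 1)|` is needed. -/
theorem kConverges_and_Theta_mul_k {t m : ℤ} (ht : 1 ≤ t) {x q : ℂ} (hq0 : q ≠ 0) (hq1 : ‖q‖ < 1)
    (hx0 : x ≠ 0) (hx : ∀ n : ℤ, x ≠ q ^ (2 * n + 1)) :
    KConverges t m x q ∧ Theta (q * x) (q ^ 2) * k t m x q = ∑' p, quadTerm t m x q p := by
  have hs := summable_quadTerm (m := m) ht hx0 hq0 hq1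
  have hΘ := Theta_ne_zero hq0 hq1 hx0 hx
  have hden : ∀ r : ℤ, 1 - x * q ^ (2 * r + 1) ≠ 0 := fun r h => by
    refine hx (-r - 1) ?_
    rw [show 2 * (-r - 1) + 1 = -(2 * r + 1) by ring, zpow_neg]
    exact eq_inv_of_mul_eq_one_left (sub_eq_zero.1 h).symm
  have hinner : ∀ p : ℤ × ℤ, ∑' p' : ℤ × ℤ, quadTerm t m x q (p', p) =
      Theta (q * x) (q ^ 2) * (sg2 p.1 p.2 * kTerm t m x q p) := fun p => by
    have : ∑' p' : ℤ × ℤ, quadTerm t m x q (p', p) = hecke 2 2 2 (x⁻¹ * q) (q ^ (2 * p.1 + 2)) q *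
        heckeTerm 2 (2 * t) 1 (q ^ (2 * t)) (q ^ (2 * m)) q p := by
      rw [hecke, ← tsum_mul_right]
      rfl
    rw [this, sg2_mul_kTerm hq0, ← hecke_two_two_two_mul hx0 hq0 hq1 p.1]
    have := hden p.1
    field_simp
  have hk : Summable fun p : ℤ × ℤ => sg2 p.1 p.2 * kTerm t m x q p := by
    have h := (hs.prod_symm.prod).congr hinner
    exact (summable_mul_left_iff hΘ).1 h
  obtain ⟨h1, h2⟩ := summable_quadrants hk
  refine ⟨⟨summable_subtype_iff_indicator.2 h1, summable_subtype_iff_indicator.2 h2⟩, ?_⟩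
  rw [k, tsum_subtype, tsum_subtype, ← h1.tsum_sub h2,
    tsum_congr (indicator_sub_indicator_eq (kTerm t m x q)), ← tsum_mul_left,
    ← (Equiv.prodComm _ _).tsum_eq (quadTerm t m x q)]
  exact ((hs.prod_symm.tsum_prod).trans (tsum_congr hinner)).symm

theorem sg_residue {n κ : ℤ} (h0 : 0 ≤ κ) (h1 : κ < n) (s : ℤ) : sg (κ + n * s) = sg s := by
  unfold sg
  congr 1
  refine propext ⟨fun h => ?_, fun h => by nlinarith⟩
  by_contra hs
  nlinarith

/-- Summing the quadruple series over `(r, s)` first, and then over `i` by residues modulo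
`2 t ^ 2 - 1`. -/
theorem Theta_mul_k_eq {t m : ℤ} (ht : 1 ≤ t) {x q : ℂ} (hq0 : q ≠ 0) (hq1 : ‖q‖ < 1)
    (hx0 : x ≠ 0) (hx : ∀ n : ℤ, x ≠ q ^ (2 * n + 1)) :
    Theta (q * x) (q ^ 2) * k t m x q = q ^ (-2 * t ^ 2 + 3 * t - 4 * t * m) *
      ∑ κ ∈ Finset.Icc (0 : ℤ) (2 * t ^ 2 - 2), (-1) ^ (κ + 1) * q ^ (κ ^ 2 + 3 * κ) *
        hecke 2 (2 * t) 1 (q ^ (2 * t + 2 - 4 * t ^ 2 + 2 * κ)) (q ^ (2 * m)) q *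
          hecke 2 (4 * t ^ 2 - 2) (4 * t ^ 2 * (2 * t ^ 2 - 1)) (x⁻¹ * q ^ (2 * κ + 1))
            (-q ^ (4 * t ^ 2 * κ - 2 + 3 * t - 4 * t * m + 4 * t ^ 4)) q := by
  have hs := summable_quadTerm (m := m) ht hx0 hq0 hq1
  have hinner : ∀ p : ℤ × ℤ, ∑' p' : ℤ × ℤ, quadTerm t m x q (p, p') =
      heckeTerm 2 2 2 (x⁻¹ * q) (q ^ (2 : ℤ)) q p *
        hecke 2 (2 * t) 1 (q ^ (2 * t + 2 * p.2)) (q ^ (2 * m)) q := fun p => by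
    rw [tsum_congr fun p' => quadTerm_eq hq0 t m x (p, p'), hecke, ← tsum_mul_left]
  have hG := hs.prod.congr hinner
  rw [(kConverges_and_Theta_mul_k ht hq0 hq1 hx0 hx).2, hs.tsum_prod, tsum_congr hinner,
    tsum_eq_sum_tsum_residue (n := 2 * t ^ 2 - 1) (by nlinarith) hG, Finset.mul_sum,
    show 2 * t ^ 2 - 1 - 1 = 2 * t ^ 2 - 2 by ring]
  refine Finset.sum_congr rfl fun κ hκ => ?_
  rw [Finset.mem_Icc] at hκ
  rw [hecke.eq_def 2 (4 * t ^ 2 - 2), ← tsum_mul_left, ← tsum_mul_left]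
  refine tsum_congr fun ⟨ρ, s⟩ => ?_
  simp only [hecke_zpow_residue ht hq0 hq1]
  generalize hecke _ _ _ _ _ _ = H
  simp only [heckeTerm, sg2, sg_residue (n := 2 * t ^ 2 - 1) hκ.1 (by omega)]
  have e1 := two_mul_binom2 ρ
  have e2 := two_mul_binom2 (κ + (2 * t ^ 2 - 1) * s)
  have e3 := two_mul_binom2 s
  have hsign : (-1 : ℂ) ^ (ρ + (κ + (2 * t ^ 2 - 1) * s)) * (-1) ^ (s + 1) =
      (-1) ^ (κ + 1) * ((-1) ^ (ρ + s) * (-1) ^ s) := by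
    -- The modulus `2 t ^ 2 - 1` is odd, so `(-1) ^ ((2 t ^ 2 - 1) s) = (-1) ^ s`.
    simp only [← zpow_add₀ (by norm_num : (-1 : ℂ) ≠ 0)]
    exact neg_one_zpow_congr ((t ^ 2 - 1) * s) (by ring)
  have hpow : q ^ ρ * q ^ (2 * (κ + (2 * t ^ 2 - 1) * s)) * q ^ (2 * binom2 ρ +
        2 * ρ * (κ + (2 * t ^ 2 - 1) * s) + 2 * binom2 (κ + (2 * t ^ 2 - 1) * s)) *
      q ^ ((s + 1) * (-2 * t ^ 2 + 3 * t - 4 * t * m + 2 * κ) + (2 * t ^ 2 - 1) * (s * (s + 1))) =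
      q ^ (-2 * t ^ 2 + 3 * t - 4 * t * m) * q ^ (κ ^ 2 + 3 * κ) * q ^ ((2 * κ + 1) * ρ) *
        q ^ ((4 * t ^ 2 * κ - 2 + 3 * t - 4 * t * m + 4 * t ^ 4) * s) *
        q ^ (2 * binom2 ρ + (4 * t ^ 2 - 2) * ρ * s +
          4 * t ^ 2 * (2 * t ^ 2 - 1) * binom2 s) := by
    simp only [← zpow_add₀ hq0]
    congr 1
    linear_combination e2 - (2 * t ^ 2 * (2 * t ^ 2 - 1)) * e3
  rw [neg_eq_neg_one_mul (q ^ (4 * t ^ 2 * κ - 2 + 3 * t - 4 * t * m + 4 * t ^ 4)), mul_zpow,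
    mul_zpow, mul_zpow, ← zpow_mul, ← zpow_mul, ← zpow_mul]
  linear_combination (x⁻¹ ^ ρ * H * ((sg ρ + sg s) / 2)) *
    (q ^ ρ * q ^ (2 * (κ + (2 * t ^ 2 - 1) * s)) * q ^ (2 * binom2 ρ +
        2 * ρ * (κ + (2 * t ^ 2 - 1) * s) + 2 * binom2 (κ + (2 * t ^ 2 - 1) * s)) *
      q ^ ((s + 1) * (-2 * t ^ 2 + 3 * t - 4 * t * m + 2 * κ) +
        (2 * t ^ 2 - 1) * (s * (s + 1)))) * hsign +
    (x⁻¹ ^ ρ * H * ((sg ρ + sg s) / 2)) * ((-1) ^ (κ + 1) * ((-1) ^ (ρ + s) * (-1) ^ s)) * hpow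

end UnimodalSeries

theorem theorem1p3 (t m : ℤ) (ht : 1 ≤ t) (q x : ℂ) (hq0 : q ≠ 0) (hq1 : ‖q‖ < 1)
    (hx0 : x ≠ 0) (hx1 : x ≠ -1) (hx : ∀ n : ℤ, x ≠ q ^ (2 * n + 1)) :
    -- every double series that occurs converges absolutely
    (UnimodalSeries.KConverges t m (-1) q ∧ UnimodalSeries.KConverges t m x q ∧
      ∀ k ∈ Finset.Icc (0 : ℤ) (2 * t ^ 2 - 2),
        Summable (UnimodalSeries.heckeTerm 2 (2 * t) 1
          (q ^ (2 * t + 2 - 4 * t ^ 2 + 2 * k)) (q ^ (2 * m)) q) ∧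
        Summable (UnimodalSeries.heckeTerm 2 (4 * t ^ 2 - 2) (4 * t ^ 2 * (2 * t ^ 2 - 1))
          (-q ^ (2 * k + 1))
          (-q ^ (4 * t ^ 2 * k - 2 + 3 * t - 4 * t * m + 4 * t ^ 4)) q) ∧
        Summable (UnimodalSeries.heckeTerm 2 (4 * t ^ 2 - 2) (4 * t ^ 2 * (2 * t ^ 2 - 1))
          (x⁻¹ * q ^ (2 * k + 1))
          (-q ^ (4 * t ^ 2 * k - 2 + 3 * t - 4 * t * m + 4 * t ^ 4)) q)) ∧
    -- no denominator vanishes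
    (UnimodalSeries.qPoch q q ≠ 0 ∧ UnimodalSeries.qPoch (q ^ 2) (q ^ 2) ≠ 0 ∧
      UnimodalSeries.Theta (-q) (q ^ 2) ≠ 0 ∧ UnimodalSeries.Theta (q * x) (q ^ 2) ≠ 0) ∧
    -- the identity
    UnimodalSeries.V t m x q =
      x * q ^ (-2 * t ^ 2 + 3 * t - 4 * t * m) /
          ((1 + x) * UnimodalSeries.qPoch q q * UnimodalSeries.qPoch (q ^ 2) (q ^ 2)) *
        ∑ k ∈ Finset.Icc (0 : ℤ) (2 * t ^ 2 - 2),
          (-1) ^ (k + 1) * q ^ (k ^ 2 + 3 * k) *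
            UnimodalSeries.hecke 2 (2 * t) 1
              (q ^ (2 * t + 2 - 4 * t ^ 2 + 2 * k)) (q ^ (2 * m)) q *
            (x⁻¹ / UnimodalSeries.Theta (-q) (q ^ 2) *
                UnimodalSeries.hecke 2 (4 * t ^ 2 - 2) (4 * t ^ 2 * (2 * t ^ 2 - 1))
                  (-q ^ (2 * k + 1))
                  (-q ^ (4 * t ^ 2 * k - 2 + 3 * t - 4 * t * m + 4 * t ^ 4)) q +
              1 / UnimodalSeries.Theta (q * x) (q ^ 2) *
                UnimodalSeries.hecke 2 (4 * t ^ 2 - 2) (4 * t ^ 2 * (2 * t ^ 2 - 1))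
                  (x⁻¹ * q ^ (2 * k + 1))
                  (-q ^ (4 * t ^ 2 * k - 2 + 3 * t - 4 * t * m + 4 * t ^ 4)) q) := by
  -- The value `-1` is generic since `|q ^ (2 n + 1)| ≠ 1`.
  have hx' : ∀ n : ℤ, (-1 : ℂ) ≠ q ^ (2 * n + 1) := fun n h => by
    have h1 : ‖q‖ ^ (2 * n + 1) = ‖q‖ ^ (0 : ℤ) := by
      rw [← norm_zpow, ← h]
      simp
    have := zpow_right_injective₀ (norm_pos_iff.2 hq0) hq1.ne h1
    omega
  have hN1 : (-1 : ℂ) ≠ 0 := by norm_num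
  have hΘ1 := UnimodalSeries.Theta_ne_zero hq0 hq1 hN1 hx'
  have hΘ := UnimodalSeries.Theta_ne_zero hq0 hq1 hx0 hx
  have hk1 := UnimodalSeries.Theta_mul_k_eq (m := m) ht hq0 hq1 hN1 hx'
  have hk := UnimodalSeries.Theta_mul_k_eq (m := m) ht hq0 hq1 hx0 hx
  have hb : 0 ≤ 4 * t ^ 2 - 2 := by nlinarith
  have hc : 0 < 4 * t ^ 2 * (2 * t ^ 2 - 1) :=
    mul_pos (by positivity) (by nlinarith)
  have hQ : ‖q ^ 2‖ < 1 := by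
    rw [norm_pow]
    exact pow_lt_one₀ (norm_nonneg _) hq1 two_ne_zero
  have e : q * -1 = -q := by ring
  have e' : ∀ j : ℤ, (-1 : ℂ)⁻¹ * q ^ j = -q ^ j := fun j => by norm_num
  rw [e] at hΘ1 hk1
  simp only [e'] at hk1
  refine ⟨⟨(UnimodalSeries.kConverges_and_Theta_mul_k ht hq0 hq1 hN1 hx').1,
    (UnimodalSeries.kConverges_and_Theta_mul_k ht hq0 hq1 hx0 hx).1, fun k _ => ⟨?_, ?_, ?_⟩⟩,
    ⟨UnimodalSeries.qPoch_self_ne_zero hq1, UnimodalSeries.qPoch_self_ne_zero hQ, hΘ1, hΘ⟩, ?_⟩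
  · exact UnimodalSeries.summable_heckeTerm two_pos (by omega) one_pos (zpow_ne_zero _ hq0)
      (zpow_ne_zero _ hq0) hq0 hq1
  · exact UnimodalSeries.summable_heckeTerm two_pos hb hc (neg_ne_zero.2 (zpow_ne_zero _ hq0))
      (neg_ne_zero.2 (zpow_ne_zero _ hq0)) hq0 hq1
  · exact UnimodalSeries.summable_heckeTerm two_pos hb hc
      (mul_ne_zero (inv_ne_zero hx0) (zpow_ne_zero _ hq0))
      (neg_ne_zero.2 (zpow_ne_zero _ hq0)) hq0 hq1
  · rw [UnimodalSeries.V, UnimodalSeries.kBar, eq_div_of_mul_eq hΘ ((mul_comm _ _).trans hk),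
      eq_div_of_mul_eq hΘ1 ((mul_comm _ _).trans hk1)]
    simp only [mul_add, Finset.sum_add_distrib]
    have hA : ∀ (c Θ : ℂ) (g F : ℤ → ℂ) (S : Finset ℤ), ∑ j ∈ S, g j * (c / Θ * F j) =
        c / Θ * ∑ j ∈ S, g j * F j := fun c Θ g F S => by
      rw [Finset.mul_sum]
      exact Finset.sum_congr rfl fun j _ => by ring
    rw [hA, hA]
    simp only [div_eq_mul_inv, mul_inv]
    ring
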